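/- Let $(X,d)$ and $(Y,\partial)$ be metric spaces. A map $f:X\to Y$ is \emph{coarse Lipschitz} if there is $L>0$ with $\partial(f(x),f(x'))\le L\,d(x,x')+L$ for all $x,x'\in X$; it is a \emph{coarse Lipschitz equivalence} if moreover there is a coarse Lipschitz map $g:Y\to X$ with $\sup_{x\in X}d(g(f(x)),x)<\infty$ and $\sup_{y\in Y}\partial(f(g(y)),y)<\infty$. One says that $X$ \emph{coarse Lipschitz embeds} into $Y$ if there is a coarse Lipschitz equivalence $X\to S$ for some $S\subseteq Y$ with the induced metric. Maps $f,g:X\to Y$ are \emph{asymptotically close} if $X$ is bounded or if, for some $x_0\in X$, $\partial(f(x),g(x))/d(x,x_0)\to 0$ as $x\to\infty$ (that is, as $d(x,x_0)\to\infty$). The spaces $X$ and $Y$ are \emph{asymptotically coarse Lipschitz equivalent} if there are coarse Lipschitz maps $f:X\to Y$ and $g:Y\to X$ such that $g\circ f$ and $f\circ g$ are asymptotically close to $\mathrm{Id}_X$ and $\mathrm{Id}_Y$, respectively. \textbf{Theorem.} Let $n\ge 1$ and $1\le r<p_1<\dots<p_n<\infty$, and let all Banach spaces be over the same scalar field, $\mathbb{R}$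 or $\mathbb{C}$. If a Banach space $X$ is asymptotically coarse Lipschitz equivalent to $\ell_{p_1}\oplus\dots\oplus\ell_{p_n}$ (with, say, the maximum norm; the choice among equivalent norms is immaterial), then $\ell_r$ does not coarse Lipschitz embed into $X$. -/

import Mathlib

/-- `f` is coarse Lipschitz: for some `L > 0`, its modulus of uniform continuity
`t ↦ sup {d (f x) (f x') | d x x' ≤ t}` is at most `L * t + L` for all `t ≥ 0`. -/
def IsCoarseLipschitz {X Y : Type*} [MetricSpace X] [MetricSpace Y] (f : X → Y) : Prop :=
  ∃ L : ℝ, 0 < L ∧ ∀ x x' : X, dist (f x) (f x') ≤ L * dist x x' + L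

/-- `f` and `g` are close: `d (f x) (g x)` is bounded in `x`. -/
def AreClose {X Y : Type*} [MetricSpace Y] (f g : X → Y) : Prop :=
  ∃ C : ℝ, ∀ x : X, dist (f x) (g x) ≤ C

/-- `f` is a coarse Lipschitz equivalence (quasi-isometry). -/
def IsCoarseLipschitzEquivalence {X Y : Type*} [MetricSpace X] [MetricSpace Y]
    (f : X → Y) : Prop :=
  IsCoarseLipschitz f ∧
    ∃ g : Y → X, IsCoarseLipschitz g ∧ AreClose (g ∘ f) id ∧ AreClose (f ∘ g) id

/-- `X` coarse Lipschitz embeds into `Y`: there is a coarse Lipschitz equivalence of `X` with a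
subset of `Y`. -/
def CoarseLipschitzEmbeds (X Y : Type*) [MetricSpace X] [MetricSpace Y] : Prop :=
  ∃ (S : Set Y) (f : X → S), IsCoarseLipschitzEquivalence f

/-- `f` and `g` are asymptotically close: `X` is bounded or, for some `x₀`, the quotient
`d (f x) (g x) / d x x₀` tends to `0` as `x → ∞`, that is, as `x` leaves all bounded sets. -/
def AsymptoticallyClose {X Y : Type*} [MetricSpace X] [MetricSpace Y] (f g : X → Y) : Prop :=
  Bornology.IsBounded (Set.univ : Set X) ∨
    ∃ x₀ : X, Filter.Tendsto (fun x => dist (f x) (g x) / dist x x₀)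
      (Bornology.cobounded X) (nhds 0)

/-- `X` and `Y` are asymptotically coarse Lipschitz equivalent. -/
def AsymptoticallyCoarseLipschitzEquivalent (X Y : Type*) [MetricSpace X] [MetricSpace Y] :
    Prop :=
  ∃ (f : X → Y) (g : Y → X), IsCoarseLipschitz f ∧ IsCoarseLipschitz g ∧
    AsymptoticallyClose (g ∘ f) id ∧ AsymptoticallyClose (f ∘ g) id

open Filter Topology

/-! Suppose `φ` embeds `ℓ_r` into `X`, and `f`, `g` give the asymptotic equivalence. Since `g ∘ f`
moves `x` by only `o(‖x‖)` plus a constant, `h = f ∘ φ` is coarse Lipschitz and bounds distances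
from below up to an error `ε * (‖z‖ + ‖z'‖) + C`, for every `ε > 0`.

Apply `h` to `t` times sums of `k` distinct unit vectors. Disjoint sums are at least `t * k ^ (1 /
r)` apart, which is also their norm, so the error with small `ε` is absorbed. In the target,
changing one index costs a bounded amount `D`. Peeling off coordinatewise limits one index at a time
writes the image as a fixed vector plus `k` successive, almost disjointly supported increments of
norm at most `D`, so generic images lie within about `D * k ^ (1 / p₁)` of that vector
(`lp_exists_concentration`). As `r < p₁`, large `k` gives a contradiction. -/

/-- Adding to `x` a coordinatewise null bounded family in `ℓ_p` increases `‖x‖ ^ p` eventually by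
little more than the `p`-th power of the bound. -/
theorem lp_eventually_norm_add_rpow_le {𝕜 ι : Type*} [RCLike 𝕜] {p : ENNReal} [Fact (1 ≤ p)]
    (hp : p ≠ ⊤) {U : Filter ι} {v : ι → lp (fun _ : ℕ => 𝕜) p} {D : ℝ} (hD : ∀ a, ‖v a‖ ≤ D)
    (hv : ∀ i, Tendsto (fun a => v a i) U (𝓝 0)) (x : lp (fun _ : ℕ => 𝕜) p) :
    ∀ᶠ a in U, ‖x + v a‖ ^ p.toReal ≤ ‖x‖ ^ p.toReal + (D ^ p.toReal + 1) := by
  have hp₀ : 0 < p := zero_lt_one.trans_le Fact.out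
  have hq : 0 < p.toReal := ENNReal.toReal_pos hp₀.ne' hp
  rcases isEmpty_or_nonempty ι with hι | ⟨⟨a₀⟩⟩
  · exact Eventually.of_forall fun a => (hι.false a).elim
  have hD0 : 0 ≤ D := (norm_nonneg _).trans (hD a₀)
  set q := p.toReal
  set A := ‖x‖ ^ q + D ^ q with hA
  have hA0 : 0 ≤ A := by positivity
  obtain ⟨ε, hε, hεA⟩ : ∃ ε : ℝ, 0 < ε ∧ (ε + A ^ q⁻¹ + ε) ^ q < A + 1 := by
    have hc : Continuous fun ε : ℝ => (ε + A ^ q⁻¹ + ε) ^ q :=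
      Continuous.rpow_const (by fun_prop) fun _ => Or.inr hq.le
    have h0 : Tendsto (fun ε : ℝ => (ε + A ^ q⁻¹ + ε) ^ q) (𝓝[>] 0) (𝓝 A) := by
      have := hc.tendsto 0
      simp only [zero_add, add_zero, Real.rpow_inv_rpow hA0 hq.ne'] at this
      exact this.mono_left nhdsWithin_le_nhds
    obtain ⟨ε, h1, h2⟩ := ((h0.eventually_lt_const (lt_add_one A)).and
      self_mem_nhdsWithin).exists
    exact ⟨ε, h2, h1⟩
  obtain ⟨s, hs⟩ : ∃ s : Finset ℕ, ‖x - ∑ i ∈ s, lp.single p i (x i)‖ < ε := by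
    have h := (lp.hasSum_single hp x).eventually (Metric.ball_mem_nhds x hε)
    obtain ⟨s, hs⟩ := h.exists
    refine ⟨s, ?_⟩
    rw [← dist_eq_norm, dist_comm]
    exact hs
  have hsmall : ∀ᶠ a in U, ‖∑ i ∈ s, lp.single p i (v a i)‖ < ε := by
    have h1 : Tendsto (fun a => ∑ i ∈ s, ‖v a i‖) U (𝓝 0) := by
      simpa using tendsto_finsetSum s fun i _ => (hv i).norm
    filter_upwards [h1.eventually_lt_const hε] with a ha
    refine (norm_sum_le _ _).trans_lt ?_
    simpa only [lp.norm_single hp₀] using ha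
  filter_upwards [hsmall] with a ha
  set X := ∑ i ∈ s, lp.single p i (x i) with hX
  set V := ∑ i ∈ s, lp.single p i (v a i) with hV
  have hsingle : ∀ (y : lp (fun _ : ℕ => 𝕜) p), ∀ i ∈ s,
      (∑ j ∈ s, lp.single p j (y j)) i = y i := by
    intro y i hi
    simp only [lp.coeFn_sum, Finset.sum_apply, lp.coeFn_single, Finset.sum_pi_single, if_pos hi]
  -- This vector agrees with `x` on `s` and with `v a` off `s`, so the `q`-th powers of the two
  -- pieces add.
  have hmain : ‖X + (v a - V)‖ ^ q ≤ A := by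
    have hw : ∀ i ∈ s, (X + (v a - V)) i = x i := by
      intro i hi
      simp only [lp.coeFn_add, lp.coeFn_sub, Pi.add_apply, Pi.sub_apply]
      rw [hX, hV, hsingle _ i hi, hsingle _ i hi, sub_self, add_zero]
    have h1 := lp.norm_compl_sum_single hq (X + (v a - V)) s
    have h2 : ∑ i ∈ s, lp.single p i ((X + (v a - V)) i) = X :=
      Finset.sum_congr rfl fun i hi => by rw [hw i hi]
    have h3 : ∑ i ∈ s, ‖(X + (v a - V)) i‖ ^ q = ∑ i ∈ s, ‖x i‖ ^ q :=
      Finset.sum_congr rfl fun i hi => by rw [hw i hi]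
    rw [h2, h3, add_sub_cancel_left] at h1
    have h4 := lp.norm_compl_sum_single hq (v a) s
    have h5 := lp.norm_compl_sum_single hq x s
    have h6 : 0 ≤ ‖x - ∑ i ∈ s, lp.single p i (x i)‖ ^ q := by positivity
    have h7 : 0 ≤ ∑ i ∈ s, ‖v a i‖ ^ q := Finset.sum_nonneg fun i _ => by positivity
    have h8 : ‖v a‖ ^ q ≤ D ^ q := Real.rpow_le_rpow (norm_nonneg _) (hD a) hq.le
    linarith
  have hmain' : ‖X + (v a - V)‖ ≤ A ^ q⁻¹ := by
    rwa [Real.le_rpow_inv_iff_of_pos (norm_nonneg _) hA0 hq]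
  have htri : ‖x + v a‖ ≤ ε + A ^ q⁻¹ + ε := by
    have : x + v a = (x - X) + (X + (v a - V)) + V := by abel
    rw [this]
    exact (norm_add₃_le).trans (by gcongr)
  calc ‖x + v a‖ ^ q ≤ (ε + A ^ q⁻¹ + ε) ^ q := Real.rpow_le_rpow (norm_nonneg _) htri hq.le
    _ ≤ A + 1 := hεA.le
    _ = _ := by rw [hA]; ring

/-- Bounded families in `ℓ_p` have coordinatewise limits along ultrafilters. -/
theorem lp_exists_tendsto_coord {𝕜 ι : Type*} [RCLike 𝕜] {p : ENNReal} [Fact (1 ≤ p)]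
    (U : Ultrafilter ι) (v : ι → lp (fun _ : ℕ => 𝕜) p) {C : ℝ} (hC : ∀ a, ‖v a‖ ≤ C) :
    ∃ u : lp (fun _ : ℕ => 𝕜) p, ∀ i, Tendsto (fun a => v a i) U (𝓝 (u i)) := by
  have hp₀ : p ≠ 0 := (zero_lt_one.trans_le Fact.out).ne'
  have h : ∀ i, ∃ y : 𝕜, Tendsto (fun a => v a i) U (𝓝 y) := by
    intro i
    obtain ⟨y, -, hy⟩ := (isCompact_closedBall (0 : 𝕜) C).ultrafilter_le_nhds (U.map fun a => v a i)
      (le_principal_iff.2 <| mem_map.2 <| Filter.univ_mem' fun a : ι => by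
        simpa using (lp.norm_apply_le_norm hp₀ (v a) i).trans (hC a))
    exact ⟨y, hy⟩
  choose y hy using h
  have hmem : Memℓp y p := lp.memℓp_of_tendsto (l := (U : Filter ι)) (F := v)
    (isBounded_iff_forall_norm_le.2 ⟨C, Set.forall_mem_range.2 hC⟩) (tendsto_pi_nhds.2 hy)
  exact ⟨⟨y, hmem⟩, hy⟩

/-! ### Generic tuples and concentration in `ℓ_p` -/

/-- The filter of statements `P [a₁, …, a_k]` that hold for `U`-almost all `a₁`, for `U`-almost all
`a₂`, and so on. -/
def iteratedFilter {α : Type*} (U : Filter α) : ℕ → Filter (List α)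
  | 0 => pure []
  | k + 1 => U.bind fun a => (iteratedFilter U k).map (List.cons a)

theorem eventually_iteratedFilter_succ {α : Type*} {U : Filter α} {k : ℕ} {P : List α → Prop} :
    (∀ᶠ l in iteratedFilter U (k + 1), P l) ↔
      ∀ᶠ a in U, ∀ᶠ l in iteratedFilter U k, P (a :: l) :=
  Iff.rfl

instance iteratedFilter_neBot {α : Type*} (U : Filter α) [U.NeBot] (k : ℕ) :
    (iteratedFilter U k).NeBot := by
  induction k with
  | zero => exact pure_neBot
  | succ k ih =>
    refine ⟨fun h => ?_⟩
    have h' : ∀ᶠ l in iteratedFilter U (k + 1), False := by rw [h]; exact eventually_bot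
    obtain ⟨a, ha⟩ := (eventually_iteratedFilter_succ.1 h').exists
    exact ha.exists.choose_spec

/-- Each entry is chosen after the earlier ones and avoids any given finite set. The set `s` is
general so that the induction can add the entries already chosen. -/
theorem eventually_iteratedFilter_nodup {α : Type*} {U : Filter α} (hU : U ≤ cofinite) (k : ℕ)
    {s : Set α} (hs : s.Finite) :
    ∀ᶠ l in iteratedFilter U k, l.length = k ∧ l.Nodup ∧ ∀ b ∈ l, b ∉ s := by
  induction k generalizing s with
  | zero => exact eventually_pure.2 (by simp)
  | succ k ih =>
    rw [eventually_iteratedFilter_succ]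
    filter_upwards [hU hs.compl_mem_cofinite] with a ha
    filter_upwards [ih (hs.insert a)] with l ⟨h1, h2, h3⟩
    refine ⟨by simp [h1], List.nodup_cons.2 ⟨fun h => h3 a h (Set.mem_insert _ _), h2⟩, ?_⟩
    intro b hb
    rcases List.mem_cons.1 hb with rfl | hb
    · exact ha
    · exact fun h => h3 b hb (Set.mem_insert_of_mem _ h)

/-- A map from tuples to `ℓ_p` that moves by at most `D` when one entry changes is, for generic
`k`-tuples, within about `k ^ (1 / p) * D` of a fixed vector. -/
theorem lp_exists_concentration {𝕜 ι : Type*} [RCLike 𝕜] {p : ENNReal} [Fact (1 ≤ p)]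
    (hp : p ≠ ⊤) (U : Ultrafilter ι) {D : ℝ} (k : ℕ) (f : List ι → lp (fun _ : ℕ => 𝕜) p)
    (hf : ∀ l₁ a b l₂, ‖f (l₁ ++ a :: l₂) - f (l₁ ++ b :: l₂)‖ ≤ D) :
    ∃ u : lp (fun _ : ℕ => 𝕜) p,
      (∀ i, Tendsto (fun l => f l i) (iteratedFilter U k) (𝓝 (u i))) ∧
      ∀ x, ∀ᶠ l in iteratedFilter U k,
        ‖x + (f l - u)‖ ^ p.toReal ≤ ‖x‖ ^ p.toReal + k * (D ^ p.toReal + 1) := by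
  induction k generalizing f with
  | zero =>
    refine ⟨f [], fun i => tendsto_pure_left.2 fun s hs => mem_of_mem_nhds hs, fun x => ?_⟩
    exact eventually_pure.2 (by simp)
  | succ k ih =>
    choose v hv hvf using fun a => ih (fun l => f (a :: l)) fun l₁ b c l₂ => by
      simpa using hf (a :: l₁) b c l₂
    -- The norm of `ℓ_p` is lower semicontinuous under coordinatewise limits.
    have hvD : ∀ a b, ‖v a - v b‖ ≤ D := fun a b =>
      lp.norm_le_of_tendsto (l := iteratedFilter U k) (F := fun l => f (a :: l) - f (b :: l))
        (Eventually.of_forall fun l => hf [] a b l)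
        (tendsto_pi_nhds.2 fun i => (hv a i).sub (hv b i))
    obtain ⟨a₀⟩ : Nonempty ι := U.neBot.nonempty
    obtain ⟨u, hu⟩ := lp_exists_tendsto_coord U v (C := ‖v a₀‖ + D) fun a => by
      have := norm_le_norm_add_norm_sub' (v a) (v a₀)
      linarith [hvD a a₀]
    have huD : ∀ a, ‖v a - u‖ ≤ D := fun a =>
      lp.norm_le_of_tendsto (l := (U : Filter ι)) (F := fun b => v a - v b)
        (Eventually.of_forall fun b => hvD a b)
        (tendsto_pi_nhds.2 fun i => tendsto_const_nhds.sub (hu i))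
    refine ⟨u, fun i s hs => ?_, fun x => ?_⟩
    · obtain ⟨t, hts, ht, hut⟩ := mem_nhds_iff.1 hs
      refine eventually_iteratedFilter_succ.2 ?_
      filter_upwards [hu i (ht.mem_nhds hut)] with a ha
      filter_upwards [hv a i (ht.mem_nhds ha)] with l hl using hts hl
    · refine eventually_iteratedFilter_succ.2 ?_
      have h0 : ∀ i, Tendsto (fun a => (v a - u) i) U (𝓝 0) := fun i => by
        simpa using (hu i).sub_const (u i)
      filter_upwards [lp_eventually_norm_add_rpow_le hp huD h0 x] with a ha
      -- The induction hypothesis for every base point allows the first increment `v a - u` to be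
      -- moved into `x`.
      filter_upwards [hvf a (x + (v a - u))] with l hl
      have : x + (f (a :: l) - u) = x + (v a - u) + (f (a :: l) - v a) := by abel
      rw [this]
      push_cast
      linarith

/-! ### Separated tuples in `ℓ_r` and the clash of exponents -/

/-- The sum of the unit vectors of `ℓ_r` with indices in a list. -/
noncomputable def lpListSum (𝕜 : Type*) [RCLike 𝕜] (r : ENNReal) (l : List ℕ) :
    lp (fun _ : ℕ => 𝕜) r :=
  (l.map fun i => lp.single r i (1 : 𝕜)).sum

section ListSum

variable {𝕜 : Type*} [RCLike 𝕜] {r : ENNReal}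

theorem lpListSum_eq_sum {l : List ℕ} (hl : l.Nodup) :
    lpListSum 𝕜 r l = ∑ i ∈ l.toFinset, lp.single r i (1 : 𝕜) :=
  (List.sum_toFinset _ hl).symm

theorem norm_lpListSum_sub_le [Fact (1 ≤ r)] (l₁ l₂ : List ℕ) (a b : ℕ) :
    ‖lpListSum 𝕜 r (l₁ ++ a :: l₂) - lpListSum 𝕜 r (l₁ ++ b :: l₂)‖ ≤ 2 := by
  have hr₀ : 0 < r := zero_lt_one.trans_le Fact.out
  have : lpListSum 𝕜 r (l₁ ++ a :: l₂) - lpListSum 𝕜 r (l₁ ++ b :: l₂) =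
      lp.single r a (1 : 𝕜) - lp.single r b (1 : 𝕜) := by
    simp only [lpListSum, List.map_append, List.map_cons, List.sum_append, List.sum_cons]
    abel
  rw [this]
  refine (norm_sub_le _ _).trans ?_
  rw [lp.norm_single hr₀, lp.norm_single hr₀, norm_one]
  norm_num

theorem norm_lpListSum_rpow (hr : 0 < r.toReal) {l : List ℕ} (hl : l.Nodup) :
    ‖lpListSum 𝕜 r l‖ ^ r.toReal = l.length := by
  rw [lpListSum_eq_sum hl, lp.norm_sum_single hr (fun _ => (1 : 𝕜))]
  simp [List.toFinset_card_of_nodup hl]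

theorem length_le_norm_lpListSum_sub_rpow [Fact (1 ≤ r)] (hr : 0 < r.toReal) {l m : List ℕ}
    (hl : l.Nodup) (hm : m.Nodup) (hlm : ∀ i ∈ m, i ∉ l) :
    (l.length : ℝ) ≤ ‖lpListSum 𝕜 r l - lpListSum 𝕜 r m‖ ^ r.toReal := by
  refine le_trans ?_ (lp.sum_rpow_le_norm_rpow hr (lpListSum 𝕜 r l - lpListSum 𝕜 r m) l.toFinset)
  have h : ∀ i ∈ l.toFinset, ‖(lpListSum 𝕜 r l - lpListSum 𝕜 r m) i‖ ^ r.toReal = 1 := by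
    intro i hi
    have him : i ∉ m.toFinset := fun h => hlm i (List.mem_toFinset.1 h) (List.mem_toFinset.1 hi)
    have : (lpListSum 𝕜 r l - lpListSum 𝕜 r m) i = 1 := by
      rw [lp.coeFn_sub, Pi.sub_apply, lpListSum_eq_sum hl, lpListSum_eq_sum hm]
      simp only [lp.coeFn_sum, Finset.sum_apply, lp.coeFn_single, Finset.sum_pi_single, if_pos hi,
        if_neg him, sub_zero]
    simp [this]
  rw [Finset.sum_congr rfl h]
  simp [List.toFinset_card_of_nodup hl]

end ListSum

/-- Two generic disjoint `k`-tuples have images at distance at most about `k ^ (1 / p₀)` under a map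
from tuples to a finite sum of spaces `ℓ_p` with `p ≥ p₀`. -/
theorem pi_lp_exists_disjoint_close {𝕜 κ : Type*} [RCLike 𝕜] [Fintype κ] {p : κ → ENNReal}
    [∀ j, Fact (1 ≤ p j)] (hp : ∀ j, p j ≠ ⊤) {p₀ : ℝ} (hp₀ : 0 < p₀)
    (hpp : ∀ j, p₀ ≤ (p j).toReal) {D : ℝ} (hD : 1 ≤ D) {k : ℕ} (hk : 1 ≤ k)
    (f : List ℕ → (j : κ) → lp (fun _ : ℕ => 𝕜) (p j))
    (hf : ∀ l₁ a b l₂, ‖f (l₁ ++ a :: l₂) - f (l₁ ++ b :: l₂)‖ ≤ D) :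
    ∃ l m : List ℕ, l.length = k ∧ m.length = k ∧ l.Nodup ∧ m.Nodup ∧ (∀ i ∈ m, i ∉ l) ∧
      ‖f l - f m‖ ≤ 4 * D * (k : ℝ) ^ p₀⁻¹ := by
  have hk' : (1 : ℝ) ≤ k := by exact_mod_cast hk
  choose u _ hu using fun j => lp_exists_concentration (hp j) (hyperfilter ℕ) k (fun l => f l j)
    fun l₁ a b l₂ => (norm_le_pi_norm (f (l₁ ++ a :: l₂) - f (l₁ ++ b :: l₂)) j).trans
      (hf l₁ a b l₂)
  have hclose : ∀ᶠ l in iteratedFilter (hyperfilter ℕ : Filter ℕ) k,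
      ∀ j, ‖f l j - u j‖ ≤ 2 * D * (k : ℝ) ^ p₀⁻¹ := by
    refine eventually_all.2 fun j => ?_
    have hq1 : 1 ≤ (p j).toReal := by
      simpa using ENNReal.toReal_mono (hp j) (Fact.out : 1 ≤ p j)
    have hq : 0 < (p j).toReal := zero_lt_one.trans_le hq1
    filter_upwards [hu j 0] with l hl
    rw [zero_add, norm_zero, Real.zero_rpow hq.ne', zero_add] at hl
    rw [← Real.rpow_le_rpow_iff (norm_nonneg _) (by positivity) hq]
    refine hl.trans ?_
    rw [Real.mul_rpow (by positivity) (by positivity), Real.mul_rpow (by positivity) (by positivity),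
      ← Real.rpow_mul (by positivity)]
    have h1 : (1 : ℝ) ≤ D ^ (p j).toReal := Real.one_le_rpow hD hq.le
    have h2 : (2 : ℝ) ≤ 2 ^ (p j).toReal := Real.self_le_rpow_of_one_le one_le_two hq1
    have h3 : (k : ℝ) ≤ (k : ℝ) ^ (p₀⁻¹ * (p j).toReal) :=
      Real.self_le_rpow_of_one_le hk' (by
        rw [inv_mul_eq_div, one_le_div hp₀]
        exact hpp j)
    calc (k : ℝ) * (D ^ (p j).toReal + 1) ≤ k * (D ^ (p j).toReal + D ^ (p j).toReal) := by gcongr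
      _ = 2 * D ^ (p j).toReal * k := by ring
      _ ≤ _ := by gcongr
  obtain ⟨l, hl, hlk, hln, -⟩ := (hclose.and
    (eventually_iteratedFilter_nodup hyperfilter_le_cofinite k Set.finite_empty)).exists
  -- Choosing `m` after `l` lets it avoid the finitely many entries of `l`.
  obtain ⟨m, hm, hmk, hmn, hml⟩ := (hclose.and
    (eventually_iteratedFilter_nodup hyperfilter_le_cofinite k l.finite_toSet)).exists
  refine ⟨l, m, hlk, hmk, hln, hmn, hml, ?_⟩
  refine (pi_norm_le_iff_of_nonneg (by positivity)).2 fun j => ?_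
  have : (f l - f m) j = (f l j - u j) - (f m j - u j) := by simp
  rw [this]
  refine (norm_sub_le _ _).trans ?_
  linarith [hl j, hm j]

/-- A coarse Lipschitz map from `ℓ_r` to a finite sum of spaces `ℓ_p` with `p > r` does not satisfy
asymptotic lower bounds. -/
theorem lp_not_asymptotic_lower_bound {𝕜 κ : Type*} [RCLike 𝕜] [Fintype κ] {r : ENNReal}
    [Fact (1 ≤ r)] (hr : r ≠ ⊤) {p : κ → ENNReal} [∀ j, Fact (1 ≤ p j)] (hp : ∀ j, p j ≠ ⊤)
    {p₀ : ℝ} (hrp : r.toReal < p₀) (hpp : ∀ j, p₀ ≤ (p j).toReal)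
    (h : lp (fun _ : ℕ => 𝕜) r → (j : κ) → lp (fun _ : ℕ => 𝕜) (p j)) {L B : ℝ} (hL : 1 ≤ L)
    (hB : 0 ≤ B) (hup : ∀ z z', dist (h z) (h z') ≤ L * dist z z' + L)
    (hlow : ∀ ε : ℝ, 0 < ε → ∃ C : ℝ, ∀ z z',
      dist z z' ≤ B * dist (h z) (h z') + ε * (‖z‖ + ‖z'‖) + C) : False := by
  have hq1 : 1 ≤ r.toReal := by simpa using ENNReal.toReal_mono hr (Fact.out : 1 ≤ r)
  have hq : 0 < r.toReal := zero_lt_one.trans_le hq1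
  have hp₀ : 0 < p₀ := hq.trans hrp
  -- Two norms of size `t * k ^ (1 / r)` then cost only half of the separation; scaling by `t ≥ max
  -- C 1` below makes the additive constants harmless.
  obtain ⟨C, hC⟩ := hlow (1 / 4) (by norm_num)
  set t : ℝ := max C 1
  have ht1 : 1 ≤ t := le_max_right _ _
  have htC : C ≤ t := le_max_left _ _
  have ht0 : 0 < t := by positivity
  have htn : ‖(t : 𝕜)‖ = t := by rw [RCLike.norm_ofReal, abs_of_pos ht0]
  have key : ∀ k : ℕ, 1 ≤ k →
      (k : ℝ) ^ r.toReal⁻¹ ≤ 2 * (12 * B * L + 1) * (k : ℝ) ^ p₀⁻¹ := by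
    intro k hk
    have hk' : (1 : ℝ) ≤ k := by exact_mod_cast hk
    have hD : 1 ≤ 3 * L * t := by nlinarith
    obtain ⟨l, m, hlk, hmk, hln, hmn, hml, hlm⟩ := pi_lp_exists_disjoint_close hp hp₀ hpp hD hk
      (fun l => h ((t : 𝕜) • lpListSum 𝕜 r l)) fun l₁ a b l₂ => by
        rw [← dist_eq_norm]
        refine (hup _ _).trans ?_
        have h1 : dist ((t : 𝕜) • lpListSum 𝕜 r (l₁ ++ a :: l₂))
            ((t : 𝕜) • lpListSum 𝕜 r (l₁ ++ b :: l₂)) ≤ t * 2 := by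
          rw [dist_eq_norm, ← smul_sub, norm_smul, htn]
          gcongr
          exact norm_lpListSum_sub_le l₁ l₂ a b
        nlinarith
    have hnorm : ∀ l : List ℕ, l.Nodup → l.length = k →
        ‖(t : 𝕜) • lpListSum 𝕜 r l‖ = t * (k : ℝ) ^ r.toReal⁻¹ := by
      intro l hl hlk
      rw [norm_smul, htn, ← hlk, ← norm_lpListSum_rpow (𝕜 := 𝕜) hq hl,
        Real.rpow_rpow_inv (norm_nonneg _) hq.ne']
    have hdist : t * (k : ℝ) ^ r.toReal⁻¹ ≤
        dist ((t : 𝕜) • lpListSum 𝕜 r l) ((t : 𝕜) • lpListSum 𝕜 r m) := by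
      rw [dist_eq_norm, ← smul_sub, norm_smul, htn]
      gcongr
      rw [Real.rpow_inv_le_iff_of_pos (by positivity) (norm_nonneg _) hq, ← hlk]
      exact length_le_norm_lpListSum_sub_rpow hq hln hmn hml
    have h1 := hC ((t : 𝕜) • lpListSum 𝕜 r l) ((t : 𝕜) • lpListSum 𝕜 r m)
    rw [hnorm l hln hlk, hnorm m hmn hmk, dist_eq_norm (h _)] at h1
    have h2 : (1 : ℝ) ≤ (k : ℝ) ^ p₀⁻¹ := Real.one_le_rpow hk' (by positivity)
    have h3 := mul_le_mul_of_nonneg_left hlm hB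
    refine le_of_mul_le_mul_left (a := t) ?_ ht0
    have h4 : C ≤ t * (k : ℝ) ^ p₀⁻¹ := htC.trans (le_mul_of_one_le_right ht0.le h2)
    linarith
  have hδ : 0 < r.toReal⁻¹ - p₀⁻¹ := sub_pos.2 (inv_strictAnti₀ hq hrp)
  have hlim := (tendsto_rpow_atTop hδ).comp (tendsto_natCast_atTop_atTop (R := ℝ))
  obtain ⟨k, hk, hk1⟩ := ((hlim.eventually_gt_atTop (2 * (12 * B * L + 1))).and
    (eventually_ge_atTop 1)).exists
  have hk0 : (0 : ℝ) < k := by exact_mod_cast hk1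
  refine (key k hk1).not_gt ?_
  have : (k : ℝ) ^ r.toReal⁻¹ = (k : ℝ) ^ (r.toReal⁻¹ - p₀⁻¹) * (k : ℝ) ^ p₀⁻¹ := by
    rw [← Real.rpow_add hk0]; congr 1; ring
  rw [this]
  exact mul_lt_mul_of_pos_right hk (by positivity)

/-! ### Coarse Lipschitz maps and the transfer to `X` -/

theorem IsCoarseLipschitz.exists_one_le {X Y : Type*} [MetricSpace X] [MetricSpace Y] {f : X → Y}
    (hf : IsCoarseLipschitz f) : ∃ L : ℝ, 1 ≤ L ∧ ∀ x x', dist (f x) (f x') ≤ L * dist x x' + L := by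
  obtain ⟨L, -, h⟩ := hf
  refine ⟨max L 1, le_max_right _ _, fun x x' => (h x x').trans ?_⟩
  gcongr <;> exact le_max_left _ _

theorem IsCoarseLipschitz.comp {X Y Z : Type*} [MetricSpace X] [MetricSpace Y] [MetricSpace Z]
    {g : Y → Z} {f : X → Y} (hg : IsCoarseLipschitz g) (hf : IsCoarseLipschitz f) :
    IsCoarseLipschitz (g ∘ f) := by
  obtain ⟨L, hL, hf⟩ := hf
  obtain ⟨M, hM, hg⟩ := hg
  refine ⟨M * L + M, by positivity, fun x x' => (hg _ _).trans ?_⟩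
  have h1 := mul_le_mul_of_nonneg_left (hf x x') hM.le
  have h2 : 0 ≤ M * dist x x' := by positivity
  linarith

/-- A coarse Lipschitz self-map asymptotically close to the identity moves `x` by at most
`ε * ‖x‖ + C`. -/
theorem AsymptoticallyClose.exists_dist_le {X : Type*} [NormedAddCommGroup X] {u : X → X}
    (hu : IsCoarseLipschitz u) (h : AsymptoticallyClose u id) {ε : ℝ} (hε : 0 < ε) :
    ∃ C : ℝ, ∀ x, dist (u x) x ≤ ε * ‖x‖ + C := by
  obtain ⟨L, hL, hu⟩ := hu
  have hbdd : ∀ R : ℝ, ∀ x, ‖x‖ ≤ R → dist (u x) x ≤ L * R + L + ‖u 0‖ + R := by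
    intro R x hx
    have h1 := hu x 0
    have h2 : dist (u x) x ≤ dist (u x) (u 0) + dist (u 0) 0 + dist 0 x := dist_triangle4 _ _ _ _
    rw [dist_zero_right] at h1 h2
    rw [dist_zero_left] at h2
    have h3 := mul_le_mul_of_nonneg_left hx hL.le
    linarith
  rcases h with h | ⟨x₀, h⟩
  · obtain ⟨R, hR⟩ := h.exists_norm_le
    refine ⟨L * R + L + ‖u 0‖ + R, fun x => (hbdd R x (hR x trivial)).trans ?_⟩
    have : 0 ≤ ε * ‖x‖ := by positivity
    linarith
  · have hev := h.eventually_lt_const hε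
    obtain ⟨R, -, hR⟩ := (Metric.hasBasis_cobounded_compl_closedBall (0 : X)).eventually_iff.1 hev
    refine ⟨max (L * (max R ‖x₀‖) + L + ‖u 0‖ + max R ‖x₀‖) (ε * ‖x₀‖), fun x => ?_⟩
    by_cases hx : ‖x‖ ≤ max R ‖x₀‖
    · refine (hbdd _ x hx).trans ?_
      have : 0 ≤ ε * ‖x‖ := by positivity
      linarith [le_max_left (L * (max R ‖x₀‖) + L + ‖u 0‖ + max R ‖x₀‖) (ε * ‖x₀‖)]
    · rw [not_le, max_lt_iff] at hx
      have h1 := hR (x := x) (by simpa using hx.1)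
      have hpos : 0 < dist x x₀ := dist_pos.2 fun h => by simp [h] at hx
      rw [div_lt_iff₀ hpos] at h1
      have h2 : dist x x₀ ≤ ‖x‖ + ‖x₀‖ := dist_le_norm_add_norm x x₀
      have h3 := mul_le_mul_of_nonneg_left h2 hε.le
      have h4 : dist (u x) x < ε * dist x x₀ := h1
      linarith [le_max_right (L * (max R ‖x₀‖) + L + ‖u 0‖ + max R ‖x₀‖) (ε * ‖x₀‖)]

theorem mainTheorem8 {𝕜 : Type*} [RCLike 𝕜]
    (n : ℕ) (hn : 0 < n)
    (r : ENNReal) [Fact (1 ≤ r)]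
    (p : Fin n → ENNReal) [∀ k, Fact (1 ≤ p k)]
    (hr : r < p ⟨0, hn⟩) (hp : StrictMono p) (hp_fin : ∀ k, p k < ⊤)
    (X : Type*) [NormedAddCommGroup X] [NormedSpace 𝕜 X] [CompleteSpace X]
    (hX : AsymptoticallyCoarseLipschitzEquivalent X
      ((k : Fin n) → lp (fun _ : ℕ => 𝕜) (p k))) :
    ¬ CoarseLipschitzEmbeds (lp (fun _ : ℕ => 𝕜) r) X := by
  rintro ⟨S, φ, hφ, ψ, hψ, ⟨c, hc⟩, -⟩
  obtain ⟨f, g, hf, hg, hgf, -⟩ := hX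
  have hφ' : IsCoarseLipschitz fun z => (φ z : X) := hφ
  have hlim := fun ε (hε : 0 < ε) => hgf.exists_dist_le (hg.comp hf) (ε := ε) hε
  obtain ⟨L, hL, hup⟩ := (hf.comp hφ').exists_one_le
  obtain ⟨P, hP, hφ'⟩ := hφ'.exists_one_le
  obtain ⟨Q, hQ, hψ⟩ := hψ.exists_one_le
  obtain ⟨G, hG, hg⟩ := hg.exists_one_le
  refine lp_not_asymptotic_lower_bound (hr.trans (hp_fin _)).ne (fun k => (hp_fin k).ne)
    ((ENNReal.toReal_lt_toReal (hr.trans (hp_fin _)).ne (hp_fin _).ne).2 hr)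
    (fun k => ENNReal.toReal_mono (hp_fin k).ne (hp.monotone (Fin.mk_le_of_le_val (Nat.zero_le _))))
    (f ∘ fun z => (φ z : X)) hL (B := Q * G) (by positivity) hup fun ε hε => ?_
  -- The factor `P` comes from `‖φ z‖ ≤ P * ‖z‖ + const`, the factor `Q` from pulling back by `ψ`.
  obtain ⟨C, hC⟩ := hlim (ε / (Q * P)) (by positivity)
  have hmove : ∀ z, Q * dist (g (f (φ z))) (φ z) ≤
      ε * ‖z‖ + Q * (ε / (Q * P) * (P + ‖(φ 0 : X)‖) + C) := by
    intro z
    have h1 := hφ' z 0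
    rw [dist_zero_right] at h1
    have h2 : ‖(φ z : X)‖ ≤ dist (φ z : X) (φ 0) + ‖(φ 0 : X)‖ := by
      rw [dist_eq_norm]; exact norm_le_norm_sub_add _ _
    have h3 : Q * (ε / (Q * P) * (P * ‖z‖ + P + ‖(φ 0 : X)‖) + C) =
        ε * ‖z‖ + Q * (ε / (Q * P) * (P + ‖(φ 0 : X)‖) + C) := by
      field_simp
      ring
    rw [← h3]
    refine mul_le_mul_of_nonneg_left ((hC _).trans ?_) (by positivity)
    gcongr
    linarith
  refine ⟨2 * (Q * (ε / (Q * P) * (P + ‖(φ 0 : X)‖) + C)) + Q * G + Q + 2 * c, fun z z' => ?_⟩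
  have h1 : dist z z' ≤ dist z (ψ (φ z)) + dist (ψ (φ z)) (ψ (φ z')) + dist (ψ (φ z')) z' :=
    dist_triangle4 _ _ _ _
  have h2 : dist (ψ (φ z)) z ≤ c := hc z
  have h3 : dist (ψ (φ z')) z' ≤ c := hc z'
  have h4 : dist (ψ (φ z)) (ψ (φ z')) ≤ Q * dist (φ z : X) (φ z') + Q := hψ _ _
  have h5 : dist (φ z : X) (φ z') ≤ dist (φ z : X) (g (f (φ z))) +
      dist (g (f (φ z))) (g (f (φ z'))) + dist (g (f (φ z'))) (φ z' : X) := dist_triangle4 _ _ _ _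
  have h6 := hg (f (φ z)) (f (φ z'))
  have h7 := mul_le_mul_of_nonneg_left (h5.trans (add_le_add_left (add_le_add_right h6 _) _))
    (zero_le_one.trans hQ)
  have h8 := hmove z
  have h9 := hmove z'
  rw [dist_comm] at h2 h8
  simp only [Function.comp_apply]
  linarith
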